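/- Let $m\ge 1$ be an integer, and consider an urn that contains at time $0$ a number $W_0\ge 1$ of white balls and a number $B_0\ge 1$ of blue balls, with $W_0+B_0\ge m$. Let $(X_n)_{n\ge 0}$ and $(Y_n)_{n\ge 0}$ be two sequences of strictly positive integer-valued random variables; the $X_n$ are identically distributed with mean $\mu_X$ and finite variance, and the $Y_n$ are identically distributed with mean $\mu_Y$ and finite variance. At each step $n\ge 1$ a sample of $m$ balls is drawn from the urn without replacement; let $\xi_n$ be the number of white balls in the sample. The sample is returned together with $X_n\xi_n$ new white balls and $Y_n(m-\xi_n)$ new blue balls, so that the numbers $W_n$ and $B_n$ of white and blue balls after $n$ steps and the total $T_n=W_n+B_n$ satisfy $$\begin{pmatrix}W_n\\ B_n\end{pmatrix}=\begin{pmatrix}W_{n-1}\\ B_{n-1}\end{pmatrix}+Q_n\begin{pmatrix}\xi_n\\ m-\xi_n\end{pmatrix},\qquad Q_n=\begin{pmatrix}X_n&0\\0&Y_n\end{pmatrix}.$$ Let $\mathcal F_n$ be the $\sigma$-field generated by $(\xi_i,X_i,Y_i)$, $1\le i\le n$. It is assumed that, for every $n\ge1$ and $0\le k\le m$, $$\mathbb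 P[\xi_n=k\mid\mathcal F_{n-1}]=\binom{W_{n-1}}{k}\binom{B_{n-1}}{m-k}\Big/\binom{T_{n-1}}{m}\quad\text{a.s.},$$ and that the pair $(X_n,Y_n)$ is independent of $\mathcal F_{n-1}\vee\sigma(\xi_n)$ ($X_n$ and $Y_n$ may depend on each other). (1) If $\mu_X>\mu_Y$, then, with $\rho=\mu_Y/\mu_X$, there is an almost surely positive random variable $B_\infty$ such that almost surely, as $n\to\infty$, $$T_n=m\mu_X n+o(n),\qquad W_n=m\mu_X n+o(n),\qquad B_n=B_\infty n^{\rho}+o(n^{\rho}).$$ (2) If $\mu_X=\mu_Y$, then there is an almost surely positive random variable $W_\infty$ such that almost surely, as $n\to\infty$, $$T_n=m\mu_X n+o(n),\qquad W_n=W_\infty n+o(n),\qquad B_n=(m\mu_X-W_\infty)\,n+o(n).$$ -/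

import Mathlib

open MeasureTheory ProbabilityTheory Filter Asymptotics
open scoped Matrix

namespace Urn

/-- The probability of `k` white balls in a sample of `m` balls drawn without replacement from an
urn with `w` white and `b` blue balls. -/
noncomputable def hypergeometric (m w b k : ℕ) : ℝ :=
  if k ≤ m then ((w.choose k : ℝ) * (b.choose (m - k) : ℝ)) / ((w + b).choose m : ℝ) else 0

variable {Ω : Type*}

/-- The composition (white, blue) of the urn after `n` draws: at draw `n + 1` the `m` sampled balls,
`ξ (n + 1)` of which are white, are put back together with `Q (n + 1) (ξ (n + 1), m - ξ (n + 1))ᵗ`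
further balls. -/
def composition (m w₀ b₀ : ℕ) (Q : ℕ → Ω → Matrix (Fin 2) (Fin 2) ℕ) (ξ : ℕ → Ω → ℕ) :
    ℕ → Ω → Fin 2 → ℕ
  | 0, _ => ![w₀, b₀]
  | n + 1, ω => composition m w₀ b₀ Q ξ n ω + Q (n + 1) ω *ᵥ ![ξ (n + 1) ω, m - ξ (n + 1) ω]

/-- The number `W_n` of white balls. -/
def white (m w₀ b₀ : ℕ) (Q : ℕ → Ω → Matrix (Fin 2) (Fin 2) ℕ) (ξ : ℕ → Ω → ℕ) (n : ℕ) (ω : Ω) :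
    ℕ := composition m w₀ b₀ Q ξ n ω 0

/-- The number `B_n` of blue balls. -/
def blue (m w₀ b₀ : ℕ) (Q : ℕ → Ω → Matrix (Fin 2) (Fin 2) ℕ) (ξ : ℕ → Ω → ℕ) (n : ℕ) (ω : Ω) :
    ℕ := composition m w₀ b₀ Q ξ n ω 1

/-- The total number `T_n` of balls. -/
def total (m w₀ b₀ : ℕ) (Q : ℕ → Ω → Matrix (Fin 2) (Fin 2) ℕ) (ξ : ℕ → Ω → ℕ) (n : ℕ) (ω : Ω) :
    ℕ := white m w₀ b₀ Q ξ n ω + blue m w₀ b₀ Q ξ n ω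

/-- The σ-field `ℱ_n` generated by the first `n` draws: by the samples `ξ 1, …, ξ n` and the
replacement matrices `Q 1, …, Q n`. -/
@[reducible] def history (Q : ℕ → Ω → Matrix (Fin 2) (Fin 2) ℕ) (ξ : ℕ → Ω → ℕ) (n : ℕ) : MeasurableSpace Ω :=
  ⨆ i ∈ Finset.Icc 1 n, (MeasurableSpace.comap (Q i) ⊤ ⊔ MeasurableSpace.comap (ξ i) ⊤)

/-- `ξ` and `Q` drive an urn with initial composition `(w₀, b₀)` from which `m` balls are drawn
without replacement at each step. -/
structure IsUrn [mΩ : MeasurableSpace Ω] (P : Measure Ω) (m w₀ b₀ : ℕ)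
    (Q : ℕ → Ω → Matrix (Fin 2) (Fin 2) ℕ) (ξ : ℕ → Ω → ℕ) : Prop where
  measurable_matrix : ∀ n, Measurable[mΩ, ⊤] (Q n)
  measurable_sample : ∀ n, Measurable (ξ n)
  /-- Given the first `n` draws, the number of white balls in the next sample is hypergeometric. -/
  sample_law : ∀ n k : ℕ,
    P[({ω | ξ (n + 1) ω = k}).indicator (fun _ => (1 : ℝ)) | history Q ξ n] =ᵐ[P]
      fun ω => hypergeometric m (white m w₀ b₀ Q ξ n ω) (blue m w₀ b₀ Q ξ n ω) k
  /-- The replacement matrix is independent of the previous draws and of the current sample.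
  In particular the matrices `Q 1, Q 2, …` are independent. -/
  indep_matrix : ∀ n : ℕ,
    Indep (MeasurableSpace.comap (Q (n + 1)) ⊤)
      (history Q ξ n ⊔ MeasurableSpace.comap (ξ (n + 1)) ⊤) P

/-- The replacement matrices `diag (X_n, Y_n)`. -/
def diagonalMatrix (X Y : ℕ → Ω → ℕ) (n : ℕ) (ω : Ω) : Matrix (Fin 2) (Fin 2) ℕ :=
  !![X n ω, 0; 0, Y n ω]

end Urn

/-! Each colour is treated alone. If `Z` is its count, then `Z (n + 1) = Z n * (1 + u n)` with `u n
= V n * η n / Z n`, where `η n` is the number of sampled balls of that colour and `V n` its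
replacement factor. The hypergeometric mean and the independence of `V n` make the conditional mean
of `u n` equal to `m μ / T n`, in which `Z` no longer appears. Hence `log (Z n) - m μ ∑ 1 / T k`
converges almost surely (`ae_exists_tendsto_log_sub`) once `∑ E (u n)²` is finite. No growth rate of
`Z` is needed for that: as `η² ≤ m η`, it suffices to bound `∑ E (η / Z²)`, and each term is at most
a constant times the decrease of `E (1 / Z)` in one step, so the sum telescopes
(`summable_integral_div_sq`).

The rest is deterministic, path by path. With `a = m μX` and `S n = ∑ a / T k`, `W n` is asymptotic
to a positive multiple of `exp (S n)` and `B n` to one of `exp (ρ S n)`. So `T n ~ κ exp (S n)`, the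
increments of `exp (S n)` tend to `a / κ`, and Cesàro averaging gives `exp (S n) ~ (a / κ) n`
(`tendsto_exp_sum_div`). Substituting back yields all the asymptotics; for `ρ < 1` the constant `κ`
comes from white alone and cancels in `W n / n`. -/

namespace Urn

/-! ### Almost sure convergence of random series -/

section Probability

variable {Ω : Type*} {mΩ : MeasurableSpace Ω} {P : Measure Ω}

/-- Nonnegative functions with summable integrals are summable almost everywhere. -/
theorem ae_summable_of_summable_integral {f : ℕ → Ω → ℝ} (hf : ∀ n, Integrable (f n) P)
    (h0 : ∀ n, 0 ≤ᵐ[P] f n) (hs : Summable fun n => ∫ ω, f n ω ∂P) :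
    ∀ᵐ ω ∂P, Summable fun n => f n ω := by
  have key : ∀ᵐ ω ∂P, Summable fun n => ‖f n ω‖ := by
    refine summable_norm_of_tsum_eLpNorm_ne_top (p := 1) le_rfl
      (fun n => (hf n).aestronglyMeasurable) ?_
    have : ∀ n, eLpNorm (f n) 1 P = ENNReal.ofReal (∫ ω, f n ω ∂P) := fun n => by
      rw [eLpNorm_one_eq_lintegral_enorm, ← ofReal_integral_norm_eq_lintegral_enorm (hf n)]
      congr 1
      refine integral_congr_ae ?_
      filter_upwards [h0 n] with ω hω using Real.norm_of_nonneg hω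
    simp_rw [this]
    exact hs.tsum_ofReal_ne_top
  filter_upwards [key] with ω hω using hω.of_norm

/-- A series of square-integrable martingale differences converges almost surely if the sum of the
second moments is finite. -/
theorem ae_exists_tendsto_sum_of_condExp_eq_zero [IsProbabilityMeasure P] {ℱ : Filtration ℕ mΩ}
    {D : ℕ → Ω → ℝ} (hD : ∀ n, StronglyMeasurable[ℱ (n + 1)] (D n)) (hL : ∀ n, MemLp (D n) 2 P)
    (h0 : ∀ n, P[D n | ℱ n] =ᵐ[P] 0) (hs : Summable fun n => ∫ ω, D n ω ^ 2 ∂P) :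
    ∀ᵐ ω ∂P, ∃ l, Tendsto (fun n => ∑ k ∈ Finset.range n, D k ω) atTop (nhds l) := by
  set M : ℕ → Ω → ℝ := fun n => ∑ k ∈ Finset.range n, D k with hM
  have hMs : ∀ n, M (n + 1) = M n + D n := fun n => Finset.sum_range_succ _ _
  have hMad : StronglyAdapted ℱ M := fun n =>
    Finset.stronglyMeasurable_sum _ fun k hk =>
      (hD k).mono (ℱ.mono (Nat.succ_le_of_lt (Finset.mem_range.1 hk)))
  have hML : ∀ n, MemLp (M n) 2 P := fun n => memLp_finsetSum' _ fun k _ => hL k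
  have hMi : ∀ n, Integrable (M n) P := fun n => (hML n).integrable one_le_two
  have hDi : ∀ n, Integrable (D n) P := fun n => (hL n).integrable one_le_two
  have hmart : Martingale M ℱ P := by
    refine martingale_nat hMad hMi fun n => ?_
    rw [hMs]
    have h1 := condExp_add (hMi n) (hDi n) (ℱ n)
    have h2 := condExp_of_stronglyMeasurable (ℱ.le n) (hMad n) (hMi n)
    filter_upwards [h1, h0 n] with ω h1 h3
    rw [h1, Pi.add_apply, h2, h3]
    simp
  -- Increments are orthogonal to the past, so second moments add up.
  have horth : ∀ n, ∫ ω, M n ω * D n ω ∂P = 0 := fun n => by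
    have hi : Integrable (M n * D n) P := (hML n).integrable_mul (hL n)
    have h1 := condExp_mul_of_stronglyMeasurable_left (hMad n) hi (hDi n)
    have h2 : ∫ ω, (P[M n * D n | ℱ n]) ω ∂P = 0 := by
      refine integral_eq_zero_of_ae ?_
      filter_upwards [h1, h0 n] with ω h1 h3
      rw [h1, Pi.mul_apply, h3]
      simp
    rw [integral_condExp (ℱ.le n)] at h2
    exact h2
  have hsq : ∀ n, ∫ ω, M n ω ^ 2 ∂P = ∑ k ∈ Finset.range n, ∫ ω, D k ω ^ 2 ∂P := fun n => by
    induction n with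
    | zero => simp [hM]
    | succ n ih =>
      rw [Finset.sum_range_succ, ← ih, hMs]
      have e : ∀ ω, (M n + D n) ω ^ 2 = (M n ω ^ 2 + D n ω ^ 2) + 2 * (M n ω * D n ω) :=
        fun ω => by simp only [Pi.add_apply]; ring
      simp_rw [e]
      have hi : Integrable (fun ω => M n ω * D n ω) P := (hML n).integrable_mul (hL n)
      rw [integral_add (by exact (hML n).integrable_sq.add (hL n).integrable_sq) (hi.const_mul 2),
        integral_add (hML n).integrable_sq (hL n).integrable_sq, integral_const_mul, horth]
      ring
  -- From `|x| ≤ 1 + x²`: this turns the `L²` bound into the `L¹` bound that martingale convergence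
  -- asks for.
  set R : ℝ := 1 + ∑' n, ∫ ω, D n ω ^ 2 ∂P
  have hbd : ∀ n, eLpNorm (M n) 1 P ≤ (R.toNNReal : ENNReal) := fun n => by
    rw [eLpNorm_one_eq_lintegral_enorm, ← ofReal_integral_norm_eq_lintegral_enorm (hMi n)]
    refine ENNReal.ofReal_le_ofReal ?_
    calc ∫ ω, ‖M n ω‖ ∂P ≤ ∫ ω, (1 + M n ω ^ 2) ∂P := by
          refine integral_mono (hMi n).norm ((integrable_const _).add (hML n).integrable_sq) ?_
          intro ω
          simp only [Real.norm_eq_abs]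
          nlinarith [sq_abs (M n ω), sq_nonneg (|M n ω| - 1)]
      _ = 1 + ∑ k ∈ Finset.range n, ∫ ω, D k ω ^ 2 ∂P := by
          rw [integral_add (integrable_const _) (hML n).integrable_sq, hsq]
          simp
      _ ≤ R := by
          have := hs.sum_le_tsum (Finset.range n)
            fun k _ => integral_nonneg fun ω => sq_nonneg (D k ω)
          simp only [R]
          linarith
  filter_upwards [hmart.submartingale.ae_tendsto_limitProcess hbd] with ω hω
  refine ⟨_, hω.congr fun n => ?_⟩
  simp [hM]

end Probability

/-- The elementary bounds `1 - 1 / (1 + u) ≤ log (1 + u) ≤ u` suffice, so `u` need not be small. -/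
theorem abs_log_one_add_sub_le_sq {u : ℝ} (hu : 0 ≤ u) : |Real.log (1 + u) - u| ≤ u ^ 2 := by
  have h1 := Real.log_le_sub_one_of_pos (by linarith : (0 : ℝ) < 1 + u)
  have h2 := Real.one_sub_inv_le_log_of_pos (by linarith : (0 : ℝ) < 1 + u)
  have h3 : u - u ^ 2 ≤ 1 - (1 + u)⁻¹ := by
    rw [← sub_nonneg]
    have : 1 - (1 + u)⁻¹ - (u - u ^ 2) = u ^ 3 / (1 + u) := by
      field_simp
      ring
    rw [this]
    positivity
  rw [abs_le]
  constructor <;> nlinarith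

/-- If each `z (n + 1)` is `z n` times `1 + u n`, and both `∑ (u n - d n)` and `∑ (u n)²` converge,
then `log (z n) - ∑ d` converges. -/
theorem exists_tendsto_log_sub_sum {z u d : ℕ → ℝ} (hz : ∀ n, 0 < z n) (hu : ∀ n, 0 ≤ u n)
    (hstep : ∀ n, z (n + 1) = z n * (1 + u n)) (hsq : Summable fun n => u n ^ 2)
    (hsum : ∃ l, Tendsto (fun n => ∑ k ∈ Finset.range n, (u k - d k)) atTop (nhds l)) :
    ∃ l, Tendsto (fun n => Real.log (z n) - ∑ k ∈ Finset.range n, d k) atTop (nhds l) := by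
  obtain ⟨l, hl⟩ := hsum
  have h1 : Summable fun n => Real.log (1 + u n) - u n :=
    Summable.of_norm_bounded hsq fun n => abs_log_one_add_sub_le_sq (hu n)
  refine ⟨_, ((h1.hasSum.tendsto_sum_nat.add hl).const_add (Real.log (z 0))).congr fun n => ?_⟩
  induction n with
  | zero => simp
  | succ n ih =>
    rw [hstep, Real.log_mul (hz n).ne' (by linarith [hu n])]
    simp only [Finset.sum_range_succ] at ih ⊢
    linarith

/-! ### Logarithmic growth of one reinforced colour -/

section Reinforcement

variable {Ω : Type*} {mΩ : MeasurableSpace Ω} {P : Measure Ω} [IsProbabilityMeasure P]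
  {ℱ : Filtration ℕ mΩ} {Z T V η : ℕ → Ω → ℝ} {c μ s : ℝ}

/-- One step of the telescoping bound for `1 / Z`. -/
theorem div_sq_le_inv_sub_inv {z v e c : ℝ} (hz : 1 ≤ z) (hv : 1 ≤ v) (he : 0 ≤ e) (hec : e ≤ c) :
    e / z ^ 2 ≤ (c + 1) * (z⁻¹ - (z + v * e)⁻¹) := by
  have hz0 : 0 < z := by linarith
  have h1 : (z + v * e)⁻¹ ≤ (z + e)⁻¹ := by
    apply inv_anti₀ <;> nlinarith
  have h2 : z⁻¹ - (z + e)⁻¹ = e / (z * (z + e)) := by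
    have : z + e ≠ 0 := by positivity
    field_simp
    ring
  -- The constant comes from `z + e ≤ z + c ≤ (c + 1) z`, using `1 ≤ z`.
  have h3 : e / z ^ 2 ≤ (c + 1) * (e / (z * (z + e))) := by
    rw [← mul_div_assoc, div_le_div_iff₀ (by positivity) (by positivity)]
    have : z + e ≤ (c + 1) * z := by nlinarith
    have h4 : 0 ≤ e * z := by positivity
    nlinarith
  have h5 : 0 ≤ c + 1 := by linarith
  nlinarith

/-- By `div_sq_le_inv_sub_inv` the partial sums telescope and stay below `(c + 1) E (1 / Z 0)`. This
replaces any a priori lower bound on the growth of `Z`. -/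
theorem summable_integral_div_sq (hZ : ∀ n, StronglyMeasurable[ℱ n] (Z n)) (hZ1 : ∀ n ω, 1 ≤ Z n ω)
    (hη : ∀ n, StronglyMeasurable[ℱ (n + 1)] (η n)) (hη0 : ∀ n, ∀ᵐ ω ∂P, 0 ≤ η n ω)
    (hηc : ∀ n, ∀ᵐ ω ∂P, η n ω ≤ c) (hV1 : ∀ n, ∀ᵐ ω ∂P, 1 ≤ V n ω)
    (hstep : ∀ n ω, Z (n + 1) ω = Z n ω + V n ω * η n ω) :
    (∀ n, Integrable (fun ω => η n ω / Z n ω ^ 2) P) ∧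
      Summable fun n => ∫ ω, η n ω / Z n ω ^ 2 ∂P := by
  have hZm : ∀ n, StronglyMeasurable (Z n) := fun n => (hZ n).mono (ℱ.le n)
  have hηm : ∀ n, StronglyMeasurable (η n) := fun n => (hη n).mono (ℱ.le _)
  have hc : 0 ≤ c := by
    obtain ⟨ω, h1, h2⟩ := ((hη0 0).and (hηc 0)).exists
    linarith
  have hi1 : ∀ n, Integrable (fun ω => (Z n ω)⁻¹) P := fun n => by
    refine Integrable.of_bound (C := 1) (hZm n).measurable.inv.aestronglyMeasurable
      (ae_of_all _ fun ω => ?_)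
    rw [norm_inv, Real.norm_of_nonneg (by linarith [hZ1 n ω])]
    exact inv_le_one_of_one_le₀ (hZ1 n ω)
  have hi2 : ∀ n, Integrable (fun ω => η n ω / Z n ω ^ 2) P := fun n => by
    refine Integrable.of_bound (C := c)
      ((hηm n).measurable.div ((hZm n).measurable.pow_const 2)).aestronglyMeasurable ?_
    filter_upwards [hη0 n, hηc n] with ω h0 h1
    have h2 : 1 ≤ Z n ω ^ 2 := one_le_pow₀ (hZ1 n ω)
    rw [Real.norm_of_nonneg (by positivity)]
    exact (div_le_self h0 h2).trans h1
  refine ⟨hi2, summable_of_sum_range_le (c := (c + 1) * ∫ ω, (Z 0 ω)⁻¹ ∂P) (fun n => ?_)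
    fun n => ?_⟩
  · refine integral_nonneg_of_ae ?_
    filter_upwards [hη0 n] with ω h0
    exact div_nonneg h0 (sq_nonneg _)
  · have hle : ∀ n, ∫ ω, η n ω / Z n ω ^ 2 ∂P ≤
        (c + 1) * (∫ ω, (Z n ω)⁻¹ ∂P - ∫ ω, (Z (n + 1) ω)⁻¹ ∂P) := fun n => by
      rw [← integral_sub (hi1 n) (hi1 (n + 1)), ← integral_const_mul]
      refine integral_mono_ae (hi2 n) (((hi1 n).sub (hi1 (n + 1))).const_mul _) ?_
      filter_upwards [hη0 n, hηc n, hV1 n] with ω h0 h1 h2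
      simp only [hstep]
      exact div_sq_le_inv_sub_inv (hZ1 n ω) h2 h0 h1
    have h3 : 0 ≤ ∫ ω, (Z n ω)⁻¹ ∂P :=
      integral_nonneg fun ω => inv_nonneg.2 (by linarith [hZ1 n ω])
    calc ∑ i ∈ Finset.range n, ∫ ω, η i ω / Z i ω ^ 2 ∂P
        ≤ ∑ i ∈ Finset.range n,
          (c + 1) * (∫ ω, (Z i ω)⁻¹ ∂P - ∫ ω, (Z (i + 1) ω)⁻¹ ∂P) :=
          Finset.sum_le_sum fun i _ => hle i
      _ = (c + 1) * (∫ ω, (Z 0 ω)⁻¹ ∂P - ∫ ω, (Z n ω)⁻¹ ∂P) := by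
          rw [← Finset.mul_sum, Finset.sum_range_sub']
      _ ≤ _ := by nlinarith

/-- The number `Z n` of balls of one colour, reinforced at each step by `V n * η n` where `η n` has
conditional mean `c * Z n / T n` and `V n` is independent of the past and of `η n`, satisfies
`log (Z n) = c μ ∑_{k < n} 1 / T k + O(1)`, with a convergent remainder. -/
theorem ae_exists_tendsto_log_sub (hZ : ∀ n, StronglyMeasurable[ℱ n] (Z n))
    (hZ1 : ∀ n ω, 1 ≤ Z n ω) (hT : ∀ n, StronglyMeasurable[ℱ n] (T n))
    (hZT : ∀ n ω, Z n ω ≤ T n ω)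
    (hη : ∀ n, StronglyMeasurable[ℱ (n + 1)] (η n)) (hη0 : ∀ n, ∀ᵐ ω ∂P, 0 ≤ η n ω)
    (hηc : ∀ n, ∀ᵐ ω ∂P, η n ω ≤ c)
    (hV : ∀ n, StronglyMeasurable[ℱ (n + 1)] (V n)) (hV1 : ∀ n, ∀ᵐ ω ∂P, 1 ≤ V n ω)
    (hV2 : ∀ n, MemLp (V n) 2 P)
    (hμ : ∀ n, ∫ ω, V n ω ∂P = μ) (hs : ∀ n, ∫ ω, V n ω ^ 2 ∂P = s)
    (hstep : ∀ n ω, Z (n + 1) ω = Z n ω + V n ω * η n ω)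
    (hmean : ∀ n, P[η n | ℱ n] =ᵐ[P] fun ω => c * Z n ω / T n ω)
    (hind : ∀ n, Indep (MeasurableSpace.comap (V n) inferInstance)
      (ℱ n ⊔ MeasurableSpace.comap (η n) inferInstance) P) :
    ∀ᵐ ω ∂P, ∃ l, Tendsto (fun n => Real.log (Z n ω) -
      ∑ k ∈ Finset.range n, c * μ / T k ω) atTop (nhds l) := by
  have hZm : ∀ n, StronglyMeasurable (Z n) := fun n => (hZ n).mono (ℱ.le n)
  have hηm : ∀ n, StronglyMeasurable (η n) := fun n => (hη n).mono (ℱ.le _)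
  have hVm : ∀ n, StronglyMeasurable (V n) := fun n => (hV n).mono (ℱ.le _)
  have hZ0 : ∀ n ω, 0 < Z n ω := fun n ω => by linarith [hZ1 n ω]
  have hT0 : ∀ n ω, 0 < T n ω := fun n ω => (hZ0 n ω).trans_le (hZT n ω)
  have hc : 0 ≤ c := by
    obtain ⟨ω, h1, h2⟩ := ((hη0 0).and (hηc 0)).exists
    linarith
  obtain ⟨hi2, hsum⟩ := summable_integral_div_sq hZ hZ1 hη hη0 hηc hV1 hstep
  set r : ℕ → Ω → ℝ := fun n ω => η n ω / Z n ω with hr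
  -- `r n` lives on the σ-field of which `V n` is independent, so the two factors of `u n` separate.
  have hrG : ∀ n, StronglyMeasurable[ℱ n ⊔ MeasurableSpace.comap (η n) inferInstance] (r n) :=
    fun n => by
      have h1 : Measurable[ℱ n ⊔ MeasurableSpace.comap (η n) inferInstance] (η n) :=
        (comap_measurable (η n)).mono le_sup_right le_rfl
      have h2 : Measurable[ℱ n ⊔ MeasurableSpace.comap (η n) inferInstance] (Z n) :=
        (hZ n).measurable.mono le_sup_left le_rfl
      exact (h1.div h2).stronglyMeasurable
  have hGle : ∀ n, ℱ n ⊔ MeasurableSpace.comap (η n) inferInstance ≤ mΩ := fun n =>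
    sup_le (ℱ.le n) (hηm n).measurable.comap_le
  have hrm : ∀ n, StronglyMeasurable (r n) := fun n => (hrG n).mono (hGle n)
  have hrtop : ∀ n, MemLp (r n) ⊤ P := fun n => by
    refine memLp_top_of_bound (hrm n).aestronglyMeasurable c ?_
    filter_upwards [hη0 n, hηc n] with ω h0 h1
    rw [Real.norm_of_nonneg (div_nonneg h0 (hZ0 n ω).le)]
    exact (div_le_self h0 (hZ1 n ω)).trans h1
  set u : ℕ → Ω → ℝ := fun n ω => V n ω * r n ω with hu
  have hu2 : ∀ n, MemLp (u n) 2 P := fun n => (hrtop n).mul' (hV2 n)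
  -- Independence factors the second moment, and `η² ≤ c η` reduces `r²` to the telescoping
  -- quantity.
  have husq : ∀ n, ∫ ω, u n ω ^ 2 ∂P ≤ s * (c * ∫ ω, η n ω / Z n ω ^ 2 ∂P) := fun n => by
    have hif : IndepFun (fun ω => V n ω ^ 2) (fun ω => r n ω ^ 2) P := by
      have : IndepFun (V n) (r n) P := by
        rw [IndepFun_iff_Indep]
        exact indep_of_indep_of_le_right (hind n) (hrG n).measurable.comap_le
      exact this.comp (φ := fun x => x ^ 2) (ψ := fun x => x ^ 2) (by fun_prop) (by fun_prop)
    have e : ∀ ω, u n ω ^ 2 = V n ω ^ 2 * r n ω ^ 2 := fun ω => mul_pow _ _ _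
    simp_rw [e]
    rw [hif.integral_fun_mul_eq_mul_integral ((hVm n).measurable.pow_const 2).aestronglyMeasurable
      ((hrm n).measurable.pow_const 2).aestronglyMeasurable, hs]
    have hs0 : 0 ≤ s := by
      rw [← hs n]
      exact integral_nonneg fun ω => sq_nonneg _
    refine mul_le_mul_of_nonneg_left ?_ hs0
    rw [← integral_const_mul]
    refine integral_mono_ae ((hrtop n).mono_exponent le_top).integrable_sq
      ((hi2 n).const_mul c) ?_
    filter_upwards [hη0 n, hηc n] with ω h0 h1
    simp only [hr, div_pow]
    rw [← mul_div_assoc]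
    have := hZ0 n ω
    gcongr
    nlinarith
  have husum : Summable fun n => ∫ ω, u n ω ^ 2 ∂P :=
    Summable.of_nonneg_of_le (fun n => integral_nonneg fun ω => sq_nonneg _) husq
      ((hsum.mul_left c).mul_left s)
  have hzinv : ∀ n, P[r n | ℱ n] =ᵐ[P] fun ω => c / T n ω := fun n => by
    have e : r n = (fun ω => (Z n ω)⁻¹) * η n := by
      ext ω
      simp [hr, div_eq_inv_mul]
    have hηi : Integrable (η n) P := by
      refine Integrable.of_bound (C := c) (hηm n).aestronglyMeasurable ?_
      filter_upwards [hη0 n, hηc n] with ω h0 h1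
      rwa [Real.norm_of_nonneg h0]
    have h1 := condExp_mul_of_stronglyMeasurable_left (μ := P) (m := ℱ n)
      (f := fun ω => (Z n ω)⁻¹) (g := η n) (hZ n).measurable.inv.stronglyMeasurable
      (by rw [← e]; exact (hrtop n).integrable le_top) hηi
    rw [← e] at h1
    filter_upwards [h1, hmean n] with ω h1 h2
    rw [h1, Pi.mul_apply, h2]
    have := (hZ0 n ω).ne'
    have := (hT0 n ω).ne'
    field_simp
  have hui : ∀ n, Integrable (u n) P := fun n => (hu2 n).integrable one_le_two
  -- Condition first on the past together with `η n`, which averages `V n` to `μ`, then on the past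
  -- alone.
  have hcond : ∀ n, P[u n | ℱ n] =ᵐ[P] fun ω => c * μ / T n ω := fun n => by
    have h1 : P[u n | ℱ n ⊔ MeasurableSpace.comap (η n) inferInstance] =ᵐ[P] μ • r n := by
      have h2 := condExp_mul_of_stronglyMeasurable_right (hrG n) (f := V n) (hui n)
        ((hV2 n).integrable one_le_two)
      have h3 := condExp_indep_eq (hVm n).measurable.comap_le (hGle n)
        (comap_measurable (V n)).stronglyMeasurable (hind n)
      filter_upwards [h2, h3] with ω h2 h3
      refine h2.trans ?_
      rw [Pi.mul_apply, h3, hμ]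
      rfl
    have h4 := condExp_condExp_of_le (μ := P) (f := u n)
      (le_sup_left : (ℱ n : MeasurableSpace Ω) ≤ _) (hGle n)
    have h5 := condExp_congr_ae (m := ℱ n) h1
    have h6 := condExp_smul (μ := P) μ (r n) (ℱ n)
    filter_upwards [h4, h5, h6, hzinv n] with ω h4 h5 h6 h7
    rw [← h4, h5, h6, Pi.smul_apply, h7, smul_eq_mul]
    ring
  set D : ℕ → Ω → ℝ := fun n ω => u n ω - c * μ / T n ω with hD
  have hdm : ∀ n, StronglyMeasurable[ℱ n] (fun ω => c * μ / T n ω) := fun n =>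
    ((hT n).measurable.const_div _).stronglyMeasurable
  -- Square integrability is inherited from `u n`, the drift being its conditional expectation.
  have hdL : ∀ n, MemLp (fun ω => c * μ / T n ω) 2 P := fun n =>
    ((hu2 n).condExp (m := ℱ n) one_le_two).ae_eq (hcond n)
  have hDL : ∀ n, MemLp (D n) 2 P := fun n => (hu2 n).sub (hdL n)
  have hDF : ∀ n, StronglyMeasurable[ℱ (n + 1)] (D n) := fun n => by
    have h1 : StronglyMeasurable[ℱ (n + 1)] (Z n) := (hZ n).mono (ℱ.mono n.le_succ)
    have h2 : StronglyMeasurable[ℱ (n + 1)] (r n) :=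
      ((hη n).measurable.div h1.measurable).stronglyMeasurable
    exact ((hV n).mul h2).sub ((hdm n).mono (ℱ.mono n.le_succ))
  have hD0 : ∀ n, P[D n | ℱ n] =ᵐ[P] 0 := fun n => by
    have hdi := (hdL n).integrable one_le_two
    have h1 := condExp_sub (hui n) hdi (ℱ n)
    have h2 := condExp_of_stronglyMeasurable (ℱ.le n) (hdm n) hdi
    filter_upwards [h1, hcond n] with ω h1 h3
    refine h1.trans ?_
    rw [Pi.sub_apply, h2, h3]
    simp
  -- Pythagoras: the drift is `ℱ n`-measurable, hence orthogonal to `D n`.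
  have hDsq : ∀ n, ∫ ω, D n ω ^ 2 ∂P ≤ ∫ ω, u n ω ^ 2 ∂P := fun n => by
    have hmi : Integrable (fun ω => c * μ / T n ω * D n ω) P := (hdL n).integrable_mul (hDL n)
    have h1 := condExp_mul_of_stronglyMeasurable_left (μ := P) (hdm n) hmi
      ((hDL n).integrable one_le_two)
    have h2 : ∫ ω, c * μ / T n ω * D n ω ∂P = 0 := by
      have h3 := integral_condExp (μ := P) (f := fun ω => c * μ / T n ω * D n ω) (ℱ.le n)
      rw [← h3]
      refine integral_eq_zero_of_ae ?_
      filter_upwards [h1, hD0 n] with ω h1 h3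
      refine h1.trans ?_
      rw [Pi.mul_apply, h3]
      simp
    have e : ∀ ω, u n ω ^ 2 =
        (D n ω ^ 2 + (c * μ / T n ω) ^ 2) + 2 * (c * μ / T n ω * D n ω) := fun ω => by
      simp only [hD]
      ring
    simp_rw [e]
    rw [integral_add (by exact (hDL n).integrable_sq.add (hdL n).integrable_sq) (hmi.const_mul 2),
      integral_add (hDL n).integrable_sq (hdL n).integrable_sq, integral_const_mul, h2]
    have : 0 ≤ ∫ ω, (c * μ / T n ω) ^ 2 ∂P := integral_nonneg fun ω => sq_nonneg _
    linarith
  have hDsum : Summable fun n => ∫ ω, D n ω ^ 2 ∂P :=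
    Summable.of_nonneg_of_le (fun n => integral_nonneg fun ω => sq_nonneg _) hDsq husum
  filter_upwards [ae_exists_tendsto_sum_of_condExp_eq_zero hDF hDL hD0 hDsum,
    ae_summable_of_summable_integral (fun n => (hu2 n).integrable_sq)
      (fun n => ae_of_all _ fun ω => sq_nonneg (u n ω)) husum,
    ae_all_iff.2 hη0, ae_all_iff.2 hV1] with ω h1 h2 h3 h4
  refine exists_tendsto_log_sub_sum (fun n => hZ0 n ω) (fun n => ?_) (fun n => ?_) h2 h1
  · exact mul_nonneg (by linarith [h4 n]) (div_nonneg (h3 n) (hZ0 n ω).le)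
  · rw [hstep]
    have := (hZ0 n ω).ne'
    simp only [hu, hr]
    field_simp

end Reinforcement

/-! ### Deterministic asymptotics along a path -/

section Deterministic

variable {t w b : ℕ → ℝ} {a c ρ : ℝ}

/-- If `t n` is asymptotic to `c * exp (a * ∑_{k < n} 1 / t k)`, then that exponential grows
linearly. -/
theorem tendsto_exp_sum_div (ht0 : ∀ n, 0 < t n) (ht : Tendsto t atTop atTop) (hc : 0 < c)
    (h : Tendsto (fun n => t n / Real.exp (∑ k ∈ Finset.range n, a / t k)) atTop (nhds c)) :
    Tendsto (fun n : ℕ => Real.exp (∑ k ∈ Finset.range n, a / t k) / n) atTop (nhds (a / c)) := by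
  set E : ℕ → ℝ := fun n => Real.exp (∑ k ∈ Finset.range n, a / t k) with hE
  have hinv : Tendsto (fun n => (t n)⁻¹) atTop (nhds 0) := ht.inv_tendsto_atTop
  -- The slope at `0` of `x ↦ exp (a x)`, taken along `x = 1 / t n`.
  have hder : Tendsto (fun n => t n * (Real.exp (a / t n) - 1)) atTop (nhds a) := by
    have h1 : HasDerivAt (fun x : ℝ => Real.exp (a * x)) a 0 := by
      simpa using ((hasDerivAt_id (0 : ℝ)).const_mul a).exp
    have h2 := h1.tendsto_slope_zero
    have h3 : Tendsto (fun n => (t n)⁻¹) atTop (nhdsWithin 0 {0}ᶜ) :=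
      tendsto_nhdsWithin_iff.2 ⟨hinv, Eventually.of_forall fun n => by simp [(ht0 n).ne']⟩
    refine (h2.comp h3).congr fun n => ?_
    simp [div_eq_mul_inv]
  have hdiff : Tendsto (fun n => E (n + 1) - E n) atTop (nhds (a / c)) := by
    have := hder.mul (h.inv₀ hc.ne')
    rw [div_eq_mul_inv]
    refine this.congr fun n => ?_
    have h1 : E (n + 1) = E n * Real.exp (a / t n) := by
      simp only [hE, Finset.sum_range_succ, Real.exp_add]
    have h2 : E n ≠ 0 := (Real.exp_pos _).ne'
    have h3 := (ht0 n).ne'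
    change t n * (Real.exp (a / t n) - 1) * (t n / E n)⁻¹ = _
    rw [h1]
    field_simp
  have h1 := hdiff.cesaro
  -- The averaged increments give `(E n - E 0) / n`; since `E 0 = 1`, a term `1 / n` has to be
  -- restored.
  have h2 : Tendsto (fun n : ℕ => (n : ℝ)⁻¹) atTop (nhds 0) := tendsto_inv_atTop_nhds_zero_nat
  have h3 := h1.add h2
  rw [add_zero] at h3
  refine h3.congr fun n => ?_
  rw [Finset.sum_range_sub]
  simp only [hE, Finset.range_zero, Finset.sum_empty, Real.exp_zero]
  ring

theorem tendsto_div_exp_of_log {z s : ℕ → ℝ} {l : ℝ} (hz : ∀ n, 0 < z n)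
    (h : Tendsto (fun n => Real.log (z n) - s n) atTop (nhds l)) :
    Tendsto (fun n => z n / Real.exp (s n)) atTop (nhds (Real.exp l)) := by
  refine ((Real.continuous_exp.tendsto l).comp h).congr fun n => ?_
  rw [Function.comp_apply, Real.exp_sub, Real.exp_log (hz n)]

/-- The equal-rates case: both colours grow linearly. -/
theorem exists_tendsto_of_log_eq_rate (hw : ∀ n, 0 < w n) (hb : ∀ n, 0 < b n)
    (ha : 0 < a) (ht : Tendsto (fun n => w n + b n) atTop atTop)
    (hwl : ∃ l, Tendsto (fun n => Real.log (w n) -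
      ∑ k ∈ Finset.range n, a / (w k + b k)) atTop (nhds l))
    (hbl : ∃ l, Tendsto (fun n => Real.log (b n) -
      ∑ k ∈ Finset.range n, a / (w k + b k)) atTop (nhds l)) :
    ∃ l, 0 < l ∧ Tendsto (fun n : ℕ => w n / n) atTop (nhds l) ∧
      Tendsto (fun n : ℕ => b n / n) atTop (nhds (a - l)) := by
  obtain ⟨lw, hlw⟩ := hwl
  obtain ⟨lb, hlb⟩ := hbl
  have h1 := tendsto_div_exp_of_log hw hlw
  have h2 := tendsto_div_exp_of_log hb hlb
  have hpos := add_pos (Real.exp_pos lw) (Real.exp_pos lb)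
  have h3 := tendsto_exp_sum_div (t := fun n => w n + b n) (a := a)
    (fun n => add_pos (hw n) (hb n)) ht hpos (by simpa only [add_div] using h1.add h2)
  refine ⟨Real.exp lw * (a / (Real.exp lw + Real.exp lb)), by positivity,
    (h1.mul h3).congr fun n => div_mul_div_cancel₀ (Real.exp_pos _).ne', ?_⟩
  have e : a - Real.exp lw * (a / (Real.exp lw + Real.exp lb)) =
      Real.exp lb * (a / (Real.exp lw + Real.exp lb)) := by
    field_simp
    ring
  rw [e]
  exact (h2.mul h3).congr fun n => div_mul_div_cancel₀ (Real.exp_pos _).ne'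

/-- The case of different rates: the dominant colour grows linearly, and the other one like a power
with the ratio of the rates as exponent. -/
theorem exists_tendsto_of_log_lt_rate (hw : ∀ n, 0 < w n) (hb : ∀ n, 0 < b n)
    (ha : 0 < a) (hρ0 : 0 < ρ) (hρ : ρ < 1) (ht : Tendsto (fun n => w n + b n) atTop atTop)
    (hwl : ∃ l, Tendsto (fun n => Real.log (w n) -
      ∑ k ∈ Finset.range n, a / (w k + b k)) atTop (nhds l))
    (hbl : ∃ l, Tendsto (fun n => Real.log (b n) -
      ∑ k ∈ Finset.range n, ρ * a / (w k + b k)) atTop (nhds l)) :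
    Tendsto (fun n : ℕ => w n / n) atTop (nhds a) ∧
      Tendsto (fun n : ℕ => b n / n) atTop (nhds 0) ∧
      ∃ l, 0 < l ∧ Tendsto (fun n : ℕ => b n / (n : ℝ) ^ ρ) atTop (nhds l) := by
  obtain ⟨lw, hlw⟩ := hwl
  obtain ⟨lb, hlb⟩ := hbl
  have h1 := tendsto_div_exp_of_log hw hlw
  have h2 := tendsto_div_exp_of_log hb hlb
  set S : ℕ → ℝ := fun n => ∑ k ∈ Finset.range n, a / (w k + b k) with hS
  have eS : ∀ n, ∑ k ∈ Finset.range n, ρ * a / (w k + b k) = ρ * S n := fun n => by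
    simp only [hS, Finset.mul_sum, mul_div_assoc]
  simp only [eS] at h2
  have hSmono : Monotone S := monotone_nat_of_le_succ fun n => by
    simp only [hS, Finset.sum_range_succ]
    have := div_pos ha (add_pos (hw n) (hb n))
    linarith
  -- If `S` converged, both colours would stay bounded, against the divergence of the total.
  have hStop : Tendsto S atTop atTop := by
    rcases tendsto_atTop_of_monotone hSmono with h | ⟨l, h⟩
    · exact h
    · exfalso
      have h3 : Tendsto (fun n => w n / Real.exp (S n) * Real.exp (S n) +
          b n / Real.exp (ρ * S n) * Real.exp (ρ * S n)) atTop
          (nhds (Real.exp lw * Real.exp l + Real.exp lb * Real.exp (ρ * l))) :=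
        (h1.mul ((Real.continuous_exp.tendsto _).comp h)).add
          (h2.mul ((Real.continuous_exp.tendsto _).comp (h.const_mul ρ)))
      refine not_tendsto_nhds_of_tendsto_atTop ht _ (h3.congr fun n => ?_)
      rw [div_mul_cancel₀ _ (Real.exp_pos _).ne', div_mul_cancel₀ _ (Real.exp_pos _).ne']
  -- `b / exp S = (b / exp (ρ S)) * exp (-(1 - ρ) S)`: blue does not contribute to the leading order
  -- of the total.
  have h4 : Tendsto (fun n => b n / Real.exp (S n)) atTop (nhds 0) := by
    have h5 : Tendsto (fun n => Real.exp (-((1 - ρ) * S n))) atTop (nhds 0) :=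
      Real.tendsto_exp_neg_atTop_nhds_zero.comp
        (hStop.const_mul_atTop (by linarith : (0 : ℝ) < 1 - ρ))
    have h6 := h2.mul h5
    rw [mul_zero] at h6
    refine h6.congr fun n => ?_
    rw [div_eq_mul_inv, div_eq_mul_inv, ← Real.exp_neg, ← Real.exp_neg, mul_assoc, ← Real.exp_add]
    ring_nf
  have h3 : Tendsto (fun n : ℕ => Real.exp (S n) / n) atTop (nhds (a / Real.exp lw)) :=
    tendsto_exp_sum_div (t := fun n => w n + b n) (a := a)
      (fun n => add_pos (hw n) (hb n)) ht (Real.exp_pos lw)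
      (by simpa only [add_div, add_zero] using h1.add h4)
  -- The witness is the limit of `(b / exp (ρ S)) * (exp S / n) ^ ρ`.
  refine ⟨?_, ?_, Real.exp lb * (a / Real.exp lw) ^ ρ, by positivity, ?_⟩
  · have h5 := h1.mul h3
    rw [mul_div_cancel₀ _ (Real.exp_pos lw).ne'] at h5
    exact h5.congr fun n => div_mul_div_cancel₀ (Real.exp_pos _).ne'
  · have h5 := h4.mul h3
    rw [zero_mul] at h5
    exact h5.congr fun n => div_mul_div_cancel₀ (Real.exp_pos _).ne'
  · refine (h2.mul (h3.rpow_const (p := ρ) (Or.inr hρ0.le))).congr fun n => ?_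
    rw [Real.div_rpow (Real.exp_pos _).le n.cast_nonneg, ← Real.exp_mul, mul_comm (S n)]
    exact div_mul_div_cancel₀ (Real.exp_pos _).ne'

/-- Convergence of `x n / f n` as a little-o statement. -/
theorem isLittleO_sub_mul_of_tendsto_div {x f : ℕ → ℝ} {l : ℝ} (hf : ∀ᶠ n in atTop, f n ≠ 0)
    (h : Tendsto (fun n => x n / f n) atTop (nhds l)) :
    (fun n => x n - l * f n) =o[atTop] f := by
  refine (isLittleO_iff_tendsto' (hf.mono fun n hn h0 => absurd h0 hn)).2 ?_
  have := h.sub_const l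
  rw [sub_self] at this
  refine this.congr' (hf.mono fun n hn => ?_)
  field_simp

end Deterministic

/-! ### Mean of the hypergeometric law -/

/-- Absorption `k C(w, k) = w C(w - 1, k - 1)` followed by Vandermonde's identity. -/
theorem sum_mul_choose_mul_choose (m w b : ℕ) (hm : 1 ≤ m) (hw : 1 ≤ w) :
    ∑ k ∈ Finset.range (m + 1), k * (w.choose k * b.choose (m - k)) =
      w * (w + b - 1).choose (m - 1) := by
  obtain ⟨m, rfl⟩ := Nat.exists_eq_add_of_le' hm
  obtain ⟨w, rfl⟩ := Nat.exists_eq_add_of_le' hw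
  have h1 : w + 1 + b - 1 = w + b := by omega
  rw [Finset.sum_range_succ', h1, Nat.add_sub_cancel, Nat.add_choose_eq w b m,
    Finset.Nat.sum_antidiagonal_eq_sum_range_succ_mk, Finset.mul_sum]
  simp only [zero_mul, add_zero]
  refine Finset.sum_congr rfl fun k _ => ?_
  have h2 := Nat.add_one_mul_choose_eq w k
  have h3 : m + 1 - (k + 1) = m - k := by omega
  rw [h3, ← mul_assoc, ← mul_assoc, h2]
  ring

/-- The mean of the hypergeometric distribution. -/
theorem sum_mul_hypergeometric (m w b : ℕ) (hm : 1 ≤ m) (hw : 1 ≤ w) (h : m ≤ w + b) :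
    ∑ k ∈ Finset.range (m + 1), (k : ℝ) * hypergeometric m w b k = m * w / ((w + b : ℕ) : ℝ) := by
  have h1 : ∑ k ∈ Finset.range (m + 1), (k : ℝ) * hypergeometric m w b k =
      ((∑ k ∈ Finset.range (m + 1), k * (w.choose k * b.choose (m - k)) : ℕ) : ℝ) /
        ((w + b).choose m : ℝ) := by
    push_cast
    rw [Finset.sum_div]
    refine Finset.sum_congr rfl fun k hk => ?_
    rw [hypergeometric, if_pos (Finset.mem_range_succ_iff.1 hk)]
    ring
  rw [h1, sum_mul_choose_mul_choose m w b hm hw]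
  have h2 : (w + b) * (w + b - 1).choose (m - 1) = (w + b).choose m * m := by
    obtain ⟨m, rfl⟩ := Nat.exists_eq_add_of_le' hm
    obtain ⟨t, ht⟩ := Nat.exists_eq_add_of_le' (show 1 ≤ w + b by omega)
    rw [ht]
    exact Nat.add_one_mul_choose_eq t m
  have h3 : ((w + b).choose m : ℝ) ≠ 0 := by exact_mod_cast (Nat.choose_pos h).ne'
  have h4 : ((w + b : ℕ) : ℝ) ≠ 0 := by
    have : w + b ≠ 0 := by omega
    exact_mod_cast this
  have h5 : ((w + b : ℕ) : ℝ) * ((w + b - 1).choose (m - 1) : ℝ) = ((w + b).choose m : ℝ) * m := by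
    exact_mod_cast h2
  rw [div_eq_div_iff h3 h4]
  push_cast at h5 ⊢
  linear_combination (w : ℝ) * h5

/-! ### Recursions and bounds for the composition -/

section Composition

variable {Ω : Type*} (m w₀ b₀ : ℕ) (X Y ξ : ℕ → Ω → ℕ)

theorem white_succ (n : ℕ) (ω : Ω) :
    white m w₀ b₀ (diagonalMatrix X Y) ξ (n + 1) ω =
      white m w₀ b₀ (diagonalMatrix X Y) ξ n ω + X (n + 1) ω * ξ (n + 1) ω := by
  simp [white, composition, diagonalMatrix, mul_comm]

theorem blue_succ (n : ℕ) (ω : Ω) :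
    blue m w₀ b₀ (diagonalMatrix X Y) ξ (n + 1) ω =
      blue m w₀ b₀ (diagonalMatrix X Y) ξ n ω + Y (n + 1) ω * (m - ξ (n + 1) ω) := by
  simp [blue, composition, diagonalMatrix, mul_comm]

theorem le_white (n : ℕ) (ω : Ω) : w₀ ≤ white m w₀ b₀ (diagonalMatrix X Y) ξ n ω := by
  induction n with
  | zero => simp [white, composition]
  | succ n ih => rw [white_succ]; omega

theorem le_blue (n : ℕ) (ω : Ω) : b₀ ≤ blue m w₀ b₀ (diagonalMatrix X Y) ξ n ω := by
  induction n with
  | zero => simp [blue, composition]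
  | succ n ih => rw [blue_succ]; omega

theorem le_white_add_blue {ω : Ω} (hm : 1 ≤ m) (hX : ∀ n, 0 < X n ω) (hY : ∀ n, 0 < Y n ω)
    (n : ℕ) :
    n ≤ white m w₀ b₀ (diagonalMatrix X Y) ξ n ω + blue m w₀ b₀ (diagonalMatrix X Y) ξ n ω := by
  induction n with
  | zero => simp
  | succ n ih =>
    rw [white_succ, blue_succ]
    have h1 : ξ (n + 1) ω ≤ X (n + 1) ω * ξ (n + 1) ω := Nat.le_mul_of_pos_left _ (hX _)
    have h2 : m - ξ (n + 1) ω ≤ Y (n + 1) ω * (m - ξ (n + 1) ω) := Nat.le_mul_of_pos_left _ (hY _)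
    -- Even with truncated subtraction `ξ + (m - ξ) ≥ m ≥ 1`, so no bound on the sample is needed.
    omega

end Composition

/-! ### Measurability with respect to the draws -/

section History

variable {Ω : Type*} {Q : ℕ → Ω → Matrix (Fin 2) (Fin 2) ℕ} {X Y ξ : ℕ → Ω → ℕ}

theorem history_mono : Monotone (history Q ξ) := fun _ _ h =>
  biSup_mono fun _ hi => Finset.Icc_subset_Icc_right h hi

theorem comap_sup_comap_le_history {n i : ℕ} (h1 : 1 ≤ i) (hn : i ≤ n) :
    MeasurableSpace.comap (Q i) ⊤ ⊔ MeasurableSpace.comap (ξ i) ⊤ ≤ history Q ξ n :=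
  le_biSup (fun i => MeasurableSpace.comap (Q i) ⊤ ⊔ MeasurableSpace.comap (ξ i) ⊤)
    (Finset.mem_Icc.2 ⟨h1, hn⟩)

theorem comap_entry_le (i : ℕ) (j k : Fin 2) :
    MeasurableSpace.comap (fun ω => Q i ω j k) ⊤ ≤ MeasurableSpace.comap (Q i) ⊤ := by
  rintro s ⟨t, -, rfl⟩
  exact ⟨{A | A j k ∈ t}, trivial, rfl⟩

theorem measurable_entry_history {n i : ℕ} (h1 : 1 ≤ i) (hn : i ≤ n) (j k : Fin 2) :
    Measurable[history Q ξ n] fun ω => Q i ω j k :=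
  Measurable.of_comap_le ((comap_entry_le i j k).trans
    (le_sup_left.trans (comap_sup_comap_le_history h1 hn)))

theorem measurable_sample_history {n i : ℕ} (h1 : 1 ≤ i) (hn : i ≤ n) :
    Measurable[history Q ξ n] (ξ i) :=
  Measurable.of_comap_le (le_sup_right.trans (comap_sup_comap_le_history h1 hn))

theorem measurable_white_history (m w₀ b₀ n : ℕ) :
    Measurable[history (diagonalMatrix X Y) ξ n] (white m w₀ b₀ (diagonalMatrix X Y) ξ n) := by
  induction n with
  | zero =>
    have : white m w₀ b₀ (diagonalMatrix X Y) ξ 0 = fun _ => w₀ := by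
      ext ω
      simp [white, composition]
    rw [this]
    exact measurable_const
  | succ n ih =>
    have e : white m w₀ b₀ (diagonalMatrix X Y) ξ (n + 1) = fun ω =>
        white m w₀ b₀ (diagonalMatrix X Y) ξ n ω + X (n + 1) ω * ξ (n + 1) ω := by
      ext ω
      exact white_succ m w₀ b₀ X Y ξ n ω
    rw [e]
    have h1 : Measurable[history (diagonalMatrix X Y) ξ (n + 1)] (X (n + 1)) :=
      measurable_entry_history (Q := diagonalMatrix X Y) (Nat.le_add_left 1 n) le_rfl 0 0
    have h2 : Measurable[history (diagonalMatrix X Y) ξ (n + 1)] (ξ (n + 1)) :=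
      measurable_sample_history (Nat.le_add_left 1 n) le_rfl
    exact (ih.mono (history_mono n.le_succ) le_rfl).add (h1.mul h2)

theorem measurable_blue_history (m w₀ b₀ n : ℕ) :
    Measurable[history (diagonalMatrix X Y) ξ n] (blue m w₀ b₀ (diagonalMatrix X Y) ξ n) := by
  induction n with
  | zero =>
    have : blue m w₀ b₀ (diagonalMatrix X Y) ξ 0 = fun _ => b₀ := by
      ext ω
      simp [blue, composition]
    rw [this]
    exact measurable_const
  | succ n ih =>
    have e : blue m w₀ b₀ (diagonalMatrix X Y) ξ (n + 1) = fun ω =>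
        blue m w₀ b₀ (diagonalMatrix X Y) ξ n ω + Y (n + 1) ω * (m - ξ (n + 1) ω) := by
      ext ω
      exact blue_succ m w₀ b₀ X Y ξ n ω
    rw [e]
    have h1 : Measurable[history (diagonalMatrix X Y) ξ (n + 1)] (Y (n + 1)) :=
      measurable_entry_history (Q := diagonalMatrix X Y) (Nat.le_add_left 1 n) le_rfl 1 1
    have h2 : Measurable[history (diagonalMatrix X Y) ξ (n + 1)] (ξ (n + 1)) :=
      measurable_sample_history (Nat.le_add_left 1 n) le_rfl
    exact (ih.mono (history_mono n.le_succ) le_rfl).add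
      (h1.mul ((measurable_of_countable fun k : ℕ => m - k).comp h2))

end History

/-! ### Conditional law of the sample -/

namespace IsUrn

variable {Ω : Type*} {mΩ : MeasurableSpace Ω} {P : Measure Ω} {m w₀ b₀ : ℕ}
  {Q : ℕ → Ω → Matrix (Fin 2) (Fin 2) ℕ} {X Y ξ : ℕ → Ω → ℕ}

theorem history_le (h : IsUrn P m w₀ b₀ Q ξ) (n : ℕ) : history Q ξ n ≤ mΩ :=
  iSup₂_le fun i _ => sup_le (h.measurable_matrix i).comap_le (h.measurable_sample i).comap_le

/-- The filtration of the draws. -/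
def filtration (h : IsUrn P m w₀ b₀ Q ξ) : Filtration ℕ mΩ where
  seq := history Q ξ
  mono' := history_mono
  le' := h.history_le

/-- One matrix entry at a time is enough, which is why dependence between `X n` and `Y n` is
harmless. -/
theorem indep_comap (h : IsUrn P m w₀ b₀ Q ξ) (n : ℕ) (j k : Fin 2) (g : ℕ → ℝ) :
    Indep (MeasurableSpace.comap (fun ω => (Q (n + 1) ω j k : ℝ)) inferInstance)
      (history Q ξ n ⊔ MeasurableSpace.comap (fun ω => g (ξ (n + 1) ω)) inferInstance) P := by
  refine indep_of_indep_of_le_left (indep_of_indep_of_le_right (h.indep_matrix n) ?_) ?_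
  · refine sup_le_sup_left ?_ _
    rintro s ⟨t, -, rfl⟩
    exact ⟨g ⁻¹' t, trivial, rfl⟩
  · rintro s ⟨t, -, rfl⟩
    exact ⟨{A | (A j k : ℝ) ∈ t}, trivial, rfl⟩

variable [IsProbabilityMeasure P]

theorem ae_sample_le (h : IsUrn P m w₀ b₀ Q ξ) (n : ℕ) : ∀ᵐ ω ∂P, ξ (n + 1) ω ≤ m := by
  -- The hypergeometric weight is `0` by definition for `k > m`; integrating it gives a null event.
  have key : ∀ k, m < k → ∀ᵐ ω ∂P, ξ (n + 1) ω ≠ k := fun k hk => by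
    have hs : MeasurableSet {ω | ξ (n + 1) ω = k} :=
      h.measurable_sample (n + 1) (measurableSet_singleton k)
    have h1 : ∫ ω, ({ω | ξ (n + 1) ω = k}).indicator (fun _ => (1 : ℝ)) ω ∂P = 0 := by
      rw [← integral_condExp (h.history_le n)]
      refine integral_eq_zero_of_ae ?_
      filter_upwards [h.sample_law n k] with ω hω
      rw [hω, hypergeometric, if_neg (by omega)]
      rfl
    rw [integral_indicator_const _ hs, smul_eq_mul, mul_one, measureReal_eq_zero_iff] at h1
    rw [ae_iff]
    simpa using h1
  have := ae_all_iff.2 fun k => ae_all_iff.2 fun hk : m < k => key k hk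
  filter_upwards [this] with ω hω
  by_contra hlt
  exact hω _ (not_le.1 hlt) rfl

theorem condExp_sample (h : IsUrn P m w₀ b₀ (diagonalMatrix X Y) ξ) (hm : 1 ≤ m) (hw : 1 ≤ w₀)
    (hT : m ≤ w₀ + b₀) (n : ℕ) :
    P[fun ω => (ξ (n + 1) ω : ℝ) | history (diagonalMatrix X Y) ξ n] =ᵐ[P] fun ω =>
      m * (white m w₀ b₀ (diagonalMatrix X Y) ξ n ω : ℝ) /
        ((white m w₀ b₀ (diagonalMatrix X Y) ξ n ω +
          blue m w₀ b₀ (diagonalMatrix X Y) ξ n ω : ℕ) : ℝ) := by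
  set I : ℕ → Ω → ℝ := fun k => ({ω | ξ (n + 1) ω = k}).indicator (fun _ => (1 : ℝ)) with hI
  have hIi : ∀ k, Integrable (I k) P := fun k =>
    (integrable_const _).indicator (h.measurable_sample (n + 1) (measurableSet_singleton k))
  -- A finite sum thanks to `ae_sample_le`, so conditional expectation passes through by linearity.
  have e : (fun ω => (ξ (n + 1) ω : ℝ)) =ᵐ[P] ∑ k ∈ Finset.range (m + 1), (k : ℝ) • I k := by
    filter_upwards [h.ae_sample_le n] with ω hω
    rw [Finset.sum_apply, Finset.sum_eq_single (ξ (n + 1) ω)]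
    · simp [hI]
    · intro k _ hk
      simp [hI, hk.symm]
    · intro hk
      exact absurd (Finset.mem_range_succ_iff.2 hω) hk
  have h1 := condExp_congr_ae (m := history (diagonalMatrix X Y) ξ n) e
  have h2 := condExp_finsetSum (μ := P) (s := Finset.range (m + 1))
    (f := fun k => (k : ℝ) • I k) (fun k _ => (hIi k).smul _) (history (diagonalMatrix X Y) ξ n)
  have h3 := ae_all_iff.2 fun k : ℕ =>
    condExp_smul (μ := P) (k : ℝ) (I k) (history (diagonalMatrix X Y) ξ n)
  filter_upwards [h1, h2, h3, ae_all_iff.2 (h.sample_law n)] with ω h1 h2 h3 h4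
  rw [h1, h2, Finset.sum_apply, ← sum_mul_hypergeometric _ _ _ hm
    (hw.trans (le_white m w₀ b₀ X Y ξ n ω))
    (hT.trans (add_le_add (le_white m w₀ b₀ X Y ξ n ω) (le_blue m w₀ b₀ X Y ξ n ω)))]
  refine Finset.sum_congr rfl fun k _ => ?_
  rw [h3, Pi.smul_apply, h4, smul_eq_mul]

theorem condExp_sub_sample (h : IsUrn P m w₀ b₀ (diagonalMatrix X Y) ξ) (hm : 1 ≤ m) (hw : 1 ≤ w₀)
    (hT : m ≤ w₀ + b₀) (n : ℕ) :
    P[fun ω => ((m - ξ (n + 1) ω : ℕ) : ℝ) | history (diagonalMatrix X Y) ξ n] =ᵐ[P] fun ω =>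
      m * (blue m w₀ b₀ (diagonalMatrix X Y) ξ n ω : ℝ) /
        ((white m w₀ b₀ (diagonalMatrix X Y) ξ n ω +
          blue m w₀ b₀ (diagonalMatrix X Y) ξ n ω : ℕ) : ℝ) := by
  have e : (fun ω => ((m - ξ (n + 1) ω : ℕ) : ℝ)) =ᵐ[P]
      (fun _ => (m : ℝ)) - fun ω => (ξ (n + 1) ω : ℝ) := by
    filter_upwards [h.ae_sample_le n] with ω hω
    rw [Nat.cast_sub hω]
    rfl
  have hi : Integrable (fun ω => (ξ (n + 1) ω : ℝ)) P := by
    refine Integrable.of_bound (C := m)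
      (measurable_from_top.comp (h.measurable_sample (n + 1))).aestronglyMeasurable ?_
    filter_upwards [h.ae_sample_le n] with ω hω
    simpa using hω
  have h1 := condExp_congr_ae (m := history (diagonalMatrix X Y) ξ n) e
  have h2 := condExp_sub (μ := P) (integrable_const (m : ℝ)) hi (history (diagonalMatrix X Y) ξ n)
  filter_upwards [h1, h2, h.condExp_sample hm hw hT n] with ω h1 h2 h3
  rw [h1, h2, Pi.sub_apply, h3, condExp_const (h.history_le n)]
  have h4 : 0 < white m w₀ b₀ (diagonalMatrix X Y) ξ n ω := hw.trans (le_white m w₀ b₀ X Y ξ n ω)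
  have h5 : (0 : ℝ) < white m w₀ b₀ (diagonalMatrix X Y) ξ n ω := by exact_mod_cast h4
  push_cast
  field_simp
  ring

end IsUrn

/-- Identical laws supply step-independent constants `μ` and `s` for `ae_exists_tendsto_log_sub`. -/
theorem memLp_and_integral_of_identDistrib {Ω : Type*} {mΩ : MeasurableSpace Ω} {P : Measure Ω}
    {X : ℕ → Ω → ℕ} (hX : ∀ n, IdentDistrib (X n) (X 0) P P)
    (hX2 : MemLp (fun ω => (X 0 ω : ℝ)) 2 P) (n : ℕ) :
    MemLp (fun ω => (X n ω : ℝ)) 2 P ∧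
      ∫ ω, (X n ω : ℝ) ∂P = ∫ ω, (X 0 ω : ℝ) ∂P ∧
      ∫ ω, (X n ω : ℝ) ^ 2 ∂P = ∫ ω, (X 0 ω : ℝ) ^ 2 ∂P := by
  have h1 : IdentDistrib (fun ω => (X n ω : ℝ)) (fun ω => (X 0 ω : ℝ)) P P :=
    (hX n).comp (u := fun k : ℕ => (k : ℝ)) measurable_from_top
  exact ⟨h1.symm.memLp_snd hX2, h1.integral_eq,
    (h1.comp (u := fun x : ℝ => x ^ 2) (by fun_prop)).integral_eq⟩

/-! ### Logarithmic growth of the two colours -/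

namespace IsUrn

variable {Ω : Type*} {mΩ : MeasurableSpace Ω} {P : Measure Ω} [IsProbabilityMeasure P]
  {m w₀ b₀ : ℕ} {X Y ξ : ℕ → Ω → ℕ}

theorem ae_exists_tendsto_log_white (h : IsUrn P m w₀ b₀ (diagonalMatrix X Y) ξ) (hm : 1 ≤ m)
    (hw : 1 ≤ w₀) (hT : m ≤ w₀ + b₀) (hX_pos : ∀ n, ∀ᵐ ω ∂P, 0 < X n ω)
    (hX : ∀ n, IdentDistrib (X n) (X 0) P P) (hX2 : MemLp (fun ω => (X 0 ω : ℝ)) 2 P) :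
    ∀ᵐ ω ∂P, ∃ l, Tendsto (fun n => Real.log (white m w₀ b₀ (diagonalMatrix X Y) ξ n ω) -
      ∑ k ∈ Finset.range n, m * (∫ ω, (X 0 ω : ℝ) ∂P) /
        ((white m w₀ b₀ (diagonalMatrix X Y) ξ k ω : ℝ) +
          blue m w₀ b₀ (diagonalMatrix X Y) ξ k ω)) atTop (nhds l) := by
  have hWm := measurable_white_history (X := X) (Y := Y) (ξ := ξ) m w₀ b₀
  have hBm := measurable_blue_history (X := X) (Y := Y) (ξ := ξ) m w₀ b₀
  have hcast : Measurable fun k : ℕ => (k : ℝ) := measurable_from_top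
  -- Draw `n + 1` leads from time `n` to time `n + 1`, hence the shifted indices of `V` and `η`; `X
  -- 0` only represents the common law.
  refine ae_exists_tendsto_log_sub (P := P) (ℱ := h.filtration)
    (Z := fun n ω => (white m w₀ b₀ (diagonalMatrix X Y) ξ n ω : ℝ))
    (T := fun n ω => (white m w₀ b₀ (diagonalMatrix X Y) ξ n ω : ℝ) +
      blue m w₀ b₀ (diagonalMatrix X Y) ξ n ω)
    (V := fun n ω => (X (n + 1) ω : ℝ)) (η := fun n ω => (ξ (n + 1) ω : ℝ))
    (c := m) (μ := ∫ ω, (X 0 ω : ℝ) ∂P) (s := ∫ ω, (X 0 ω : ℝ) ^ 2 ∂P)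
    (fun n => (hcast.comp (hWm n)).stronglyMeasurable) (fun n ω => ?_)
    (fun n => ((hcast.comp (hWm n)).add (hcast.comp (hBm n))).stronglyMeasurable)
    (fun n ω => by simp)
    (fun n => (hcast.comp (measurable_sample_history
      (Nat.le_add_left 1 n) le_rfl)).stronglyMeasurable)
    (fun n => ae_of_all _ fun ω => Nat.cast_nonneg _) (fun n => ?_)
    (fun n => (hcast.comp (measurable_entry_history (Q := diagonalMatrix X Y)
      (Nat.le_add_left 1 n) le_rfl 0 0)).stronglyMeasurable)
    (fun n => ?_) (fun n => (memLp_and_integral_of_identDistrib hX hX2 (n + 1)).1)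
    (fun n => (memLp_and_integral_of_identDistrib hX hX2 (n + 1)).2.1)
    (fun n => (memLp_and_integral_of_identDistrib hX hX2 (n + 1)).2.2)
    (fun n ω => ?_) (fun n => ?_)
    (fun n => h.indep_comap n 0 0 fun k => (k : ℝ))
  · exact_mod_cast hw.trans (le_white m w₀ b₀ X Y ξ n ω)
  · filter_upwards [h.ae_sample_le n] with ω hω
    exact_mod_cast hω
  · filter_upwards [hX_pos (n + 1)] with ω hω
    exact_mod_cast hω
  · rw [white_succ]
    push_cast
    rfl
  · have := h.condExp_sample hm hw hT n
    push_cast at this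
    exact this

theorem ae_exists_tendsto_log_blue (h : IsUrn P m w₀ b₀ (diagonalMatrix X Y) ξ) (hm : 1 ≤ m)
    (hw : 1 ≤ w₀) (hb : 1 ≤ b₀) (hT : m ≤ w₀ + b₀) (hY_pos : ∀ n, ∀ᵐ ω ∂P, 0 < Y n ω)
    (hY : ∀ n, IdentDistrib (Y n) (Y 0) P P) (hY2 : MemLp (fun ω => (Y 0 ω : ℝ)) 2 P) :
    ∀ᵐ ω ∂P, ∃ l, Tendsto (fun n => Real.log (blue m w₀ b₀ (diagonalMatrix X Y) ξ n ω) -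
      ∑ k ∈ Finset.range n, m * (∫ ω, (Y 0 ω : ℝ) ∂P) /
        ((white m w₀ b₀ (diagonalMatrix X Y) ξ k ω : ℝ) +
          blue m w₀ b₀ (diagonalMatrix X Y) ξ k ω)) atTop (nhds l) := by
  have hWm := measurable_white_history (X := X) (Y := Y) (ξ := ξ) m w₀ b₀
  have hBm := measurable_blue_history (X := X) (Y := Y) (ξ := ξ) m w₀ b₀
  have hcast : Measurable fun k : ℕ => (k : ℝ) := measurable_from_top
  have hsub : Measurable fun k : ℕ => ((m - k : ℕ) : ℝ) := measurable_from_top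
  refine ae_exists_tendsto_log_sub (P := P) (ℱ := h.filtration)
    (Z := fun n ω => (blue m w₀ b₀ (diagonalMatrix X Y) ξ n ω : ℝ))
    (T := fun n ω => (white m w₀ b₀ (diagonalMatrix X Y) ξ n ω : ℝ) +
      blue m w₀ b₀ (diagonalMatrix X Y) ξ n ω)
    (V := fun n ω => (Y (n + 1) ω : ℝ)) (η := fun n ω => ((m - ξ (n + 1) ω : ℕ) : ℝ))
    (c := m) (μ := ∫ ω, (Y 0 ω : ℝ) ∂P) (s := ∫ ω, (Y 0 ω : ℝ) ^ 2 ∂P)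
    (fun n => (hcast.comp (hBm n)).stronglyMeasurable) (fun n ω => ?_)
    (fun n => ((hcast.comp (hWm n)).add (hcast.comp (hBm n))).stronglyMeasurable)
    (fun n ω => by simp)
    (fun n => (hsub.comp (measurable_sample_history
      (Nat.le_add_left 1 n) le_rfl)).stronglyMeasurable)
    (fun n => ae_of_all _ fun ω => Nat.cast_nonneg _)
    (fun n => ae_of_all _ fun ω => Nat.cast_le.2 (Nat.sub_le _ _))
    (fun n => (hcast.comp (measurable_entry_history (Q := diagonalMatrix X Y)
      (Nat.le_add_left 1 n) le_rfl 1 1)).stronglyMeasurable)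
    (fun n => ?_) (fun n => (memLp_and_integral_of_identDistrib hY hY2 (n + 1)).1)
    (fun n => (memLp_and_integral_of_identDistrib hY hY2 (n + 1)).2.1)
    (fun n => (memLp_and_integral_of_identDistrib hY hY2 (n + 1)).2.2)
    (fun n ω => ?_) (fun n => ?_)
    (fun n => h.indep_comap n 1 1 fun k => ((m - k : ℕ) : ℝ))
  · exact_mod_cast hb.trans (le_blue m w₀ b₀ X Y ξ n ω)
  · filter_upwards [hY_pos (n + 1)] with ω hω
    exact_mod_cast hω
  · rw [blue_succ]
    push_cast
    rfl
  · have := h.condExp_sub_sample hm hw hT n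
    push_cast at this ⊢
    exact this

end IsUrn

theorem integral_pos_of_ae_pos {Ω : Type*} {mΩ : MeasurableSpace Ω} {P : Measure Ω}
    [IsProbabilityMeasure P] {X : Ω → ℕ} (h0 : ∀ᵐ ω ∂P, 0 < X ω)
    (hX : Integrable (fun ω => (X ω : ℝ)) P) : 0 < ∫ ω, (X ω : ℝ) ∂P := by
  have h1 : ∫ _, (1 : ℝ) ∂P ≤ ∫ ω, (X ω : ℝ) ∂P := by
    refine integral_mono_ae (integrable_const _) hX ?_
    filter_upwards [h0] with ω hω
    exact_mod_cast hω
  simp at h1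
  linarith

end Urn

/-! ### The limit theorem -/

theorem theorem4 {Ω : Type*} [MeasurableSpace Ω] (P : Measure Ω) [IsProbabilityMeasure P]
    (m w₀ b₀ : ℕ) (hm : 1 ≤ m) (hw : 1 ≤ w₀) (hb : 1 ≤ b₀) (hT : m ≤ w₀ + b₀)
    (X Y ξ : ℕ → Ω → ℕ)
    (hX_pos : ∀ n, ∀ᵐ ω ∂P, 0 < X n ω) (hY_pos : ∀ n, ∀ᵐ ω ∂P, 0 < Y n ω)
    (hX_ident : ∀ n, IdentDistrib (X n) (X 0) P P) (hY_ident : ∀ n, IdentDistrib (Y n) (Y 0) P P)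
    (hX_var : MemLp (fun ω => (X 0 ω : ℝ)) 2 P) (hY_var : MemLp (fun ω => (Y 0 ω : ℝ)) 2 P)
    (hUrn : Urn.IsUrn P m w₀ b₀ (Urn.diagonalMatrix X Y) ξ)
    (W B T : ℕ → Ω → ℕ)
    (hW_def : W = Urn.white m w₀ b₀ (Urn.diagonalMatrix X Y) ξ)
    (hB_def : B = Urn.blue m w₀ b₀ (Urn.diagonalMatrix X Y) ξ)
    (hT_def : T = Urn.total m w₀ b₀ (Urn.diagonalMatrix X Y) ξ)
    (μX μY : ℝ) (hμX : μX = ∫ ω, (X 0 ω : ℝ) ∂P) (hμY : μY = ∫ ω, (Y 0 ω : ℝ) ∂P) :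
    (μY < μX →
      (∀ᵐ ω ∂P, (fun n : ℕ => (T n ω : ℝ) - m * μX * n) =o[atTop] fun n : ℕ => (n : ℝ)) ∧
      (∀ᵐ ω ∂P, (fun n : ℕ => (W n ω : ℝ) - m * μX * n) =o[atTop] fun n : ℕ => (n : ℝ)) ∧
      ∃ Binf : Ω → ℝ, Measurable Binf ∧ (∀ᵐ ω ∂P, 0 < Binf ω) ∧
        ∀ᵐ ω ∂P, (fun n : ℕ => (B n ω : ℝ) - Binf ω * (n : ℝ) ^ (μY / μX)) =o[atTop]
          fun n : ℕ => (n : ℝ) ^ (μY / μX)) ∧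
    (μX = μY →
      (∀ᵐ ω ∂P, (fun n : ℕ => (T n ω : ℝ) - m * μX * n) =o[atTop] fun n : ℕ => (n : ℝ)) ∧
      ∃ Winf : Ω → ℝ, Measurable Winf ∧ (∀ᵐ ω ∂P, 0 < Winf ω) ∧
        (∀ᵐ ω ∂P, (fun n : ℕ => (W n ω : ℝ) - Winf ω * n) =o[atTop] fun n : ℕ => (n : ℝ)) ∧
        ∀ᵐ ω ∂P, (fun n : ℕ => (B n ω : ℝ) - (m * μX - Winf ω) * n) =o[atTop]
          fun n : ℕ => (n : ℝ)) := by
  have hW_log := hUrn.ae_exists_tendsto_log_white hm hw hT hX_pos hX_ident hX_var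
  have hB_log := hUrn.ae_exists_tendsto_log_blue hm hw hb hT hY_pos hY_ident hY_var
  rw [← hμX, ← hW_def, ← hB_def] at hW_log
  rw [← hμY, ← hW_def, ← hB_def] at hB_log
  have hμX0 : 0 < μX := hμX ▸ Urn.integral_pos_of_ae_pos (hX_pos 0) (hX_var.integrable one_le_two)
  have hμY0 : 0 < μY := hμY ▸ Urn.integral_pos_of_ae_pos (hY_pos 0) (hY_var.integrable one_le_two)
  have hm0 : (0 : ℝ) < m := by exact_mod_cast hm
  have ha : 0 < m * μX := mul_pos hm0 hμX0
  have hW0 : ∀ n ω, (0 : ℝ) < W n ω := fun n ω => by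
    rw [hW_def]
    exact_mod_cast hw.trans (Urn.le_white m w₀ b₀ X Y ξ n ω)
  have hB0 : ∀ n ω, (0 : ℝ) < B n ω := fun n ω => by
    rw [hB_def]
    exact_mod_cast hb.trans (Urn.le_blue m w₀ b₀ X Y ξ n ω)
  have hTeq : ∀ n ω, (T n ω : ℝ) = W n ω + B n ω := fun n ω => by
    rw [hT_def, hW_def, hB_def, Urn.total]
    push_cast
    rfl
  have hcast : Measurable fun k : ℕ => (k : ℝ) := measurable_from_top
  have hWm : ∀ n, Measurable fun ω => (W n ω : ℝ) := fun n => by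
    rw [hW_def]
    exact hcast.comp ((Urn.measurable_white_history m w₀ b₀ n).mono (hUrn.history_le n) le_rfl)
  have hBm : ∀ n, Measurable fun ω => (B n ω : ℝ) := fun n => by
    rw [hB_def]
    exact hcast.comp ((Urn.measurable_blue_history m w₀ b₀ n).mono (hUrn.history_le n) le_rfl)
  have hTtop : ∀ᵐ ω ∂P, Tendsto (fun n => (W n ω : ℝ) + B n ω) atTop atTop := by
    filter_upwards [ae_all_iff.2 hX_pos, ae_all_iff.2 hY_pos] with ω h1 h2
    refine tendsto_atTop_mono (fun n => ?_) tendsto_natCast_atTop_atTop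
    rw [hW_def, hB_def]
    exact_mod_cast Urn.le_white_add_blue m w₀ b₀ X Y ξ hm h1 h2 n
  have hn0 : ∀ᶠ n : ℕ in atTop, (n : ℝ) ≠ 0 :=
    (eventually_gt_atTop 0).mono fun n hn => by exact_mod_cast hn.ne'
  constructor
  · intro hlt
    have key : ∀ᵐ ω ∂P, Tendsto (fun n : ℕ => (W n ω : ℝ) / n) atTop (nhds (m * μX)) ∧
        Tendsto (fun n : ℕ => (B n ω : ℝ) / n) atTop (nhds 0) ∧
        ∃ l, 0 < l ∧ Tendsto (fun n : ℕ => (B n ω : ℝ) / (n : ℝ) ^ (μY / μX)) atTop (nhds l) := by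
      filter_upwards [hW_log, hB_log, hTtop] with ω h1 h2 h3
      refine Urn.exists_tendsto_of_log_lt_rate (fun n => hW0 n ω) (fun n => hB0 n ω) ha
        (div_pos hμY0 hμX0) ((div_lt_one hμX0).2 hlt) h3 h1 ?_
      have e : μY / μX * (m * μX) = m * μY := by field_simp
      rw [e]
      exact h2
    -- The pathwise limits are chosen separately for each `ω`; this provides a measurable version,
    -- whose positivity follows from uniqueness of limits.
    obtain ⟨Binf, hBinf, hlim⟩ := measurable_limit_of_tendsto_metrizable_ae
      (f := fun n ω => (B n ω : ℝ) / (n : ℝ) ^ (μY / μX)) (μ := P) (L := atTop)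
      (fun n => ((hBm n).div_const _).aemeasurable)
      (key.mono fun ω hω => hω.2.2.imp fun l hl => hl.2)
    refine ⟨?_, ?_, Binf, hBinf, ?_, ?_⟩
    · filter_upwards [key] with ω hω
      have := hω.1.add hω.2.1
      rw [add_zero] at this
      refine Urn.isLittleO_sub_mul_of_tendsto_div hn0 (this.congr fun n => ?_)
      rw [hTeq, add_div]
    · filter_upwards [key] with ω hω
      exact Urn.isLittleO_sub_mul_of_tendsto_div hn0 hω.1
    · filter_upwards [key, hlim] with ω hω hl
      obtain ⟨l, hl0, hl'⟩ := hω.2.2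
      rwa [tendsto_nhds_unique hl hl']
    · filter_upwards [hlim] with ω hl
      refine Urn.isLittleO_sub_mul_of_tendsto_div ?_ hl
      exact (eventually_gt_atTop 0).mono fun n hn =>
        (Real.rpow_pos_of_pos (Nat.cast_pos.2 hn) _).ne'
  · intro heq
    have key : ∀ᵐ ω ∂P, ∃ l, 0 < l ∧ Tendsto (fun n : ℕ => (W n ω : ℝ) / n) atTop (nhds l) ∧
        Tendsto (fun n : ℕ => (B n ω : ℝ) / n) atTop (nhds (m * μX - l)) := by
      rw [← heq] at hB_log
      filter_upwards [hW_log, hB_log, hTtop] with ω h1 h2 h3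
      exact Urn.exists_tendsto_of_log_eq_rate (fun n => hW0 n ω) (fun n => hB0 n ω) ha h3 h1 h2
    obtain ⟨Winf, hWinf, hlim⟩ := measurable_limit_of_tendsto_metrizable_ae
      (f := fun (n : ℕ) ω => (W n ω : ℝ) / n) (μ := P) (L := atTop)
      (fun n => ((hWm n).div_const _).aemeasurable)
      (key.mono fun ω hω => hω.imp fun l hl => hl.2.1)
    -- Uniqueness of limits identifies the pathwise `l` with `Winf ω`, which transfers the blue
    -- limit as well.
    have key' : ∀ᵐ ω ∂P, 0 < Winf ω ∧
        Tendsto (fun n : ℕ => (B n ω : ℝ) / n) atTop (nhds (m * μX - Winf ω)) := by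
      filter_upwards [key, hlim] with ω hω hl
      obtain ⟨l, hl0, hl', hb'⟩ := hω
      rw [tendsto_nhds_unique hl hl']
      exact ⟨hl0, hb'⟩
    refine ⟨?_, Winf, hWinf, key'.mono fun ω hω => hω.1, ?_, ?_⟩
    · filter_upwards [key', hlim] with ω hω hl
      have := hl.add hω.2
      rw [add_sub_cancel] at this
      refine Urn.isLittleO_sub_mul_of_tendsto_div hn0 (this.congr fun n => ?_)
      rw [hTeq, add_div]
    · filter_upwards [hlim] with ω hl
      exact Urn.isLittleO_sub_mul_of_tendsto_div hn0 hl
    · filter_upwards [key'] with ω hω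
      exact Urn.isLittleO_sub_mul_of_tendsto_div hn0 hω.2
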